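/- An \emph{ordered Abelian group} (OAG) is an Abelian group with a translation-invariant strict linear order. Let $\mathcal R=\langle R;+,<,\dots\rangle$ be an expansion of an OAG, in an arbitrary first-order language containing $+$ and $<$. ``Definable'' means definable with parameters, and topological notions refer to the order topology on $R$. Assume that (i) $\mathcal R$ is definably complete: every nonempty definable $X\subseteq R$ that is bounded above has a least upper bound in $R$; and (ii) the complete theory $T$ of $\mathcal R$ is strong: there is no inp-pattern of infinite depth in $T$, that is, there are no model $\mathcal M\models T$, formulas $\varphi_i(\bar x;\bar y_i)$ (with $\bar x$ a finite tuple of variables), positive integers $k_i$ and tuples $\bar a_{i,j}$ from $\mathcal M$ ($i,j<\omega$) such that for every $i$ the row $\{\varphi_i(\bar x;\bar a_{i,j}) : j<\omega\}$ is $k_i$-inconsistent, while for every $\eta:\omega\to\omega$ the set $\{\varphi_i(\bar x;\bar a_{i,\eta(i)}) : i<\omega\}$ is consistent. Let $D\subseteq R$ be definable and discrete. For $a\in D$ put $S_D(a)=\min\{b\in D : a<b\}$ and $\gamma_D(a)=S_D(a)-a$ if $a$ is not maximal in $D$, and $S_D^{-1}(a)=\max\{b\in D : b<a\}$ if $a$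 is not minimal in $D$. Let $\mathcal Z(a)=\{S_D^n(a) : n\in\mathbb Z,\ S_D^n(a)\text{ exists}\}$ be the $\mathbb Z$-chain of $a$, and let $\mathcal Z_{\ge}(a)$ be its subset of those $S_D^n(a)$ with $n\ge 0$. The Archimedean class of $g>0$ is $[g]=\{h\in R : h<ng \text{ and } g<nh \text{ for some } n\in\mathbb N\}$, and these classes are ordered by the order of their elements. For $a\in D$ let $C^*(a)$ be the maximal Archimedean class $C$, if there is one, such that for every $b\in\mathcal Z(a)$ there is $c\in\mathcal Z_{\ge}(b)$, not maximal in $D$, with $\gamma_D(c)\in C$. Then $C^*(a)$ exists for every $a\in D$ whose $\mathbb Z$-chain does not contain a greatest element of $D$, and the set $\{C^*(a) : a\in D,\ C^*(a)\text{ exists}\}$ is finite. -/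

import Mathlib

universe u v w

/-- `R` with its `L`-structure is an expansion of the group `R` with its order: `L` has a binary
function symbol interpreted by the addition of `R` and a binary relation symbol interpreted by the
strict order of `R`; the other symbols of `L` are arbitrary. -/
class OAGExpansion (L : FirstOrder.Language.{u, v}) (R : Type w) [L.Structure R] [AddCommGroup R]
    [LinearOrder R] [IsOrderedAddMonoid R] where
  addSymb : L.Functions 2
  ltSymb : L.Relations 2
  funMap_addSymb : ∀ x y : R, FirstOrder.Language.Structure.funMap addSymb ![x, y] = x + y
  relMap_ltSymb : ∀ x y : R, FirstOrder.Language.Structure.RelMap ltSymb ![x, y] ↔ x < y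

/-- Definable completeness: every nonempty set that is definable (with parameters) and bounded
above has a least upper bound. -/
def DefinablyComplete (L : FirstOrder.Language.{u, v}) (R : Type w) [L.Structure R] [LinearOrder R] : Prop :=
  ∀ X : Set R, (Set.univ : Set R).Definable₁ L X → X.Nonempty → BddAbove X → ∃ s, IsLUB X s

/-- `φ`, `k`, `a` form an inp-pattern in the model `M`, with rows indexed by `ι`. The variables of
`φ i` are split into the finite tuples `x` (`Fin m`) and `y` (`Fin (n i)`). A set of formulas with
parameters in `M` is consistent iff each of its finite subsets is satisfied in `M`. -/
structure IsInpPattern {L : FirstOrder.Language.{u, v}} (M : Type w) [L.Structure M] {ι : Type} {m : ℕ}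
    {n : ι → ℕ} (φ : ∀ i, L.Formula (Fin m ⊕ Fin (n i))) (k : ι → ℕ)
    (a : ∀ i, ℕ → Fin (n i) → M) : Prop where
  pos : ∀ i, 0 < k i
  /-- The `i`-th row is `k i`-inconsistent. -/
  row : ∀ i, ∀ s : Finset ℕ, s.card = k i →
    ¬ ∃ x : Fin m → M, ∀ j ∈ s, (φ i).Realize (Sum.elim x (a i j))
  /-- Every choice of one formula from each row is consistent. -/
  path : ∀ η : ι → ℕ, ∀ s : Finset ι,
    ∃ x : Fin m → M, ∀ i ∈ s, (φ i).Realize (Sum.elim x (a i (η i)))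

/-- There is an inp-pattern with rows indexed by `ι` in some model of `T`. (For countable `ι` the
universe of the model is no restriction, by the downward Löwenheim–Skolem theorem.) -/
def HasInpPattern {L : FirstOrder.Language.{u, v}} (T : L.Theory) (ι : Type) : Prop :=
  ∃ (M : FirstOrder.Language.Theory.ModelType.{u, v, max u v} T) (m : ℕ) (n : ι → ℕ)
    (φ : ∀ i, L.Formula (Fin m ⊕ Fin (n i))) (k : ι → ℕ) (a : ∀ i, ℕ → Fin (n i) → M),
    IsInpPattern M φ k a

/-- `T` is strong: every inp-pattern in `T` has finite depth, that is, there is none of depth `ω`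
(a pattern with infinitely many rows contains one with rows indexed by `ℕ`). -/
def IsStrongTheory {L : FirstOrder.Language.{u, v}} (T : L.Theory) : Prop :=
  ¬ HasInpPattern T ℕ

section Chains

variable {R : Type w} [LinearOrder R]

/-- `b = S_D(a)`: the point `a` of `D` is not maximal in `D` and `b = min {x ∈ D | a < x}`. -/
def IsSuccIn (D : Set R) (a b : R) : Prop :=
  a ∈ D ∧ IsLeast {x | x ∈ D ∧ a < x} b

/-- `b = S_D⁻¹(a)`: the point `a` of `D` is not minimal in `D` and `b = max {x ∈ D | x < a}`. -/
def IsPredIn (D : Set R) (a b : R) : Prop :=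
  a ∈ D ∧ IsGreatest {x | x ∈ D ∧ x < a} b

/-- The upper part `{S_Dⁿ(a) | n ≥ 0}` of the `ℤ`-chain of `a`. -/
def zChainGE (D : Set R) (a : R) : Set R :=
  {b | Relation.ReflTransGen (IsSuccIn D) a b}

/-- The lower part `{S_Dⁿ(a) | n ≤ 0}` of the `ℤ`-chain of `a`. -/
def zChainLE (D : Set R) (a : R) : Set R :=
  {b | Relation.ReflTransGen (IsPredIn D) a b}

/-- The `ℤ`-chain of `a` in `D`. -/
def zChain (D : Set R) (a : R) : Set R :=
  zChainGE D a ∪ zChainLE D a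

variable [AddCommGroup R] [IsOrderedAddMonoid R]

/-- The Archimedean class `C` contains a difference `S_D(c) - c` with `c` in the upper part of the
`ℤ`-chain of `b`. -/
def RepresentedGE (D : Set R) (b : R) (C : ArchimedeanClass R) : Prop :=
  ∃ c ∈ zChainGE D b, ∃ d, IsSuccIn D c d ∧ ArchimedeanClass.mk (d - c) = C

/-- `C = C*(a)`: the class `C` is the maximal Archimedean class that is represented in every tail
of the `ℤ`-chain of `a`. Mathlib orders Archimedean classes in reverse (larger elements have
smaller classes), so maximal in the usual order of classes is least in Mathlib's order. -/
def IsCStar (D : Set R) (a : R) (C : ArchimedeanClass R) : Prop :=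
  IsLeast {C' : ArchimedeanClass R | ∀ b ∈ zChain D a, RepresentedGE D b C'} C

end Chains

open FirstOrder FirstOrder.Language Filter

/-! Strength forbids independent information at infinitely many scales. Suppose that row `i`
consists of points in `[0, M i]` of a definable set whose next larger point is at distance at least
`δ i`, and that `M (i + 1) + δ (i + 1) ≤ δ i`. A sum of one point from each row determines its
summands, as a number determines its digits: the tail of the sum after row `i` is below `δ i`, so at
each scale the summand is the only spaced point `z` with the remainder in `[z, z + δ i)`. "The
`i`-th digit is `e`" is then a 2-inconsistent row, and all paths are consistent. Arbitrarily large
finite families of rows, uniformly definable, give an inp-pattern of depth ω by compactness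
(`not_isStrongTheory_of_isSpacedPoint`).

This is applied three times. A discrete `D` accumulating from above at a point would supply such
rows, so with definable completeness every non-maximal point has a successor (`exists_isSuccIn`).
Infinitely many Archimedean classes among the gaps of one successor chain would supply rows made of
gaps (`finite_range_mk_gap`); hence some class recurs forever, and the largest such class is `C*`.
Infinitely many values of `C*` would supply one row of points of `D` per value
(`finite_setOf_isCStar`). -/

/-! ### Compactness for inp-patterns -/

theorem small_of_lift_mk_le {α : Type w} {κ : Cardinal.{u}}
    (h : Cardinal.lift.{u} (Cardinal.mk α) ≤ Cardinal.lift.{w} κ) : Small.{u} α := by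
  induction κ using Cardinal.inductionOn with
  | mk β =>
    obtain ⟨f⟩ := Cardinal.lift_mk_le'.1 h
    exact small_of_injective f.injective

/-- Moves a pattern into the universe demanded by `HasInpPattern`: Löwenheim–Skolem applies if the
model is large, and otherwise the model itself is small. -/
theorem exists_small_elementarySubstructure_of_countable {L : FirstOrder.Language.{u, v}}
    {M : Type w} [L.Structure M] {A : Set M} (hA : A.Countable) :
    ∃ S : L.ElementarySubstructure M, A ⊆ S ∧ Small.{max u v} S := by
  by_cases h : Cardinal.lift.{w} (max Cardinal.aleph0 L.card) ≤ Cardinal.lift.{max u v} (Cardinal.mk M)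
  · obtain ⟨S, hAS, hS⟩ := exists_elementarySubstructure_card_eq L A
      (max Cardinal.aleph0 L.card) (le_max_left _ _)
      (by
        refine le_trans ?_ (Cardinal.lift_le.2 (le_max_left _ _))
        simpa using hA.le_aleph0)
      (Cardinal.lift_le.2 (le_max_right _ _)) h
    exact ⟨S, hAS, small_of_lift_mk_le hS.le⟩
  · have : Small.{max u v} M := small_of_lift_mk_le (not_le.1 h).le
    exact ⟨⊤, Set.subset_univ _, inferInstance⟩

theorem Set.Definable.exists_formula_split {L : FirstOrder.Language.{u, v}} {R : Type w}
    [L.Structure R] [Nonempty R] {V : Type*} {P : (V → R) → R → Prop}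
    (hP : (Set.univ : Set R).Definable L {w : Option V → R | P (w ∘ some) (w none)}) :
    ∃ (n : ℕ) (ψ : L.Formula (Fin 1 ⊕ Fin n)) (ρ : Fin n → R ⊕ V), ∀ p x,
      P p x ↔ ψ.Realize (Sum.elim (fun _ => x) (Sum.elim id p ∘ ρ)) := by
  classical
  obtain ⟨φ, hφ⟩ := Set.definable_iff_exists_formula_sum.1 hP
  let e := φ.freeVarFinset.equivFin
  let f : φ.freeVarFinset → Fin 1 ⊕ Fin φ.freeVarFinset.card := fun z =>
    match z.1 with
    | Sum.inr none => Sum.inl 0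
    | _ => Sum.inr (e z)
  let ρ : Fin φ.freeVarFinset.card → R ⊕ V := fun k =>
    match (e.symm k).1 with
    | Sum.inl r => Sum.inl r.1
    -- This value is never read: `f` sends the variable `none` to the object variable.
    | Sum.inr none => Sum.inl (Classical.arbitrary R)
    | Sum.inr (some i) => Sum.inr i
  refine ⟨_, φ.restrictFreeVar f, ρ, fun p x => ?_⟩
  have h1 : P p x ↔ φ.Realize (Sum.elim (↑) fun o : Option V => o.elim x p) := by
    have := Set.ext_iff.1 hφ fun o : Option V => o.elim x p
    exact this
  rw [h1]
  refine (BoundedFormula.realize_restrictFreeVar _ ?_).symm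
  rintro ⟨(r | _ | i), hz⟩ <;> simp [f, ρ]

/-- In an ultrapower of `R` over a nonprincipal ultrafilter the `N × N` patterns merge into an
infinite one, by Łoś. -/
theorem hasInpPattern_of_formulas {L : FirstOrder.Language.{u, v}} {R : Type w}
    [L.Structure R] [Nonempty R] {n : ℕ → ℕ} (ψ : ∀ i, L.Formula (Fin 1 ⊕ Fin (n i)))
    (b : ℕ → ∀ i, ℕ → Fin (n i) → R)
    (hrow : ∀ N, ∀ i < N, ∀ j < N, ∀ j' < N, j ≠ j' → ∀ x : R,
      (ψ i).Realize (Sum.elim (fun _ => x) (b N i j)) →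
      ¬ (ψ i).Realize (Sum.elim (fun _ => x) (b N i j')))
    (hpath : ∀ N, ∀ η : ℕ → ℕ, (∀ i < N, η i < N) → ∃ x : R, ∀ i < N,
      (ψ i).Realize (Sum.elim (fun _ => x) (b N i (η i)))) :
    HasInpPattern (L.completeTheory R) ℕ := by
  let U : Ultrafilter ℕ := hyperfilter ℕ
  have hU : ∀ k : ℕ, ∀ᶠ N in (U : Filter ℕ), k < N := fun k =>
    Nat.hyperfilter_le_atTop (eventually_gt_atTop k)
  let M := (U : Filter ℕ).Product fun _ => R
  let mkM : (ℕ → R) → M := fun f => (f : (U : Filter ℕ).Product fun _ => R)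
  let a : ∀ i, ℕ → Fin (n i) → M := fun i j t => mkM fun N => b N i j t
  have los : ∀ i j (X : ℕ → R),
      (ψ i).Realize (Sum.elim (fun _ => mkM X) (a i j)) ↔
        ∀ᶠ N in (U : Filter ℕ), (ψ i).Realize (Sum.elim (fun _ => X N) (b N i j)) := by
    intro i j X
    have := Ultraproduct.realize_formula_cast (M := fun _ : ℕ => R) (u := U) (ψ i)
      (Sum.elim (fun _ => X) (fun t N => b N i j t))
    have e1 : (fun z => ((Sum.elim (fun _ => X) (fun t N => b N i j t) z : ℕ → R) :
        (U : Filter ℕ).Product fun _ => R)) = Sum.elim (fun _ : Fin 1 => mkM X) (a i j) := by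
      funext z; rcases z with z | z <;> rfl
    have e2 : ∀ N, (fun z => Sum.elim (fun _ : Fin 1 => X) (fun t N => b N i j t) z N) =
        Sum.elim (fun _ => X N) (b N i j) := by
      intro N; funext z; rcases z with z | z <;> rfl
    rw [e1] at this
    simp only [e2] at this
    exact this
  have hsurj : ∀ x : M, ∃ X, mkM X = x := fun x => Quotient.exists_rep x
  have : M ⊨ L.completeTheory R := by
    refine Theory.model_iff _ |>.2 fun φ hφ => ?_
    exact (Ultraproduct.sentence_realize φ).2 (.of_forall fun _ => hφ)
  -- Finite sets `s` and finitely supported `η` keep the family of witnesses countable, so that a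
  -- small elementary substructure can contain them all.
  have hpathM : ∀ (s : Finset ℕ) (η : ℕ →₀ ℕ), ∃ x : M, ∀ i ∈ s,
      (ψ i).Realize (Sum.elim (fun _ => x) (a i (η i))) := by
    intro s η
    have hx : ∀ N, ∃ x : R, (∀ i < N, η i < N) → ∀ i < N,
        (ψ i).Realize (Sum.elim (fun _ => x) (b N i (η i))) := by
      intro N
      by_cases h : ∀ i < N, η i < N
      · obtain ⟨x, hx⟩ := hpath N η h
        exact ⟨x, fun _ => hx⟩
      · exact ⟨Classical.arbitrary R, fun h' => (h h').elim⟩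
    choose X hX using hx
    refine ⟨mkM X, fun i hi => (los i _ X).2 ?_⟩
    filter_upwards [hU i, hU (η.support.sup η)] with N h1 h2
    refine hX N (fun k hk => ?_) i h1
    by_cases hk' : k ∈ η.support
    · exact (Finset.le_sup hk').trans_lt h2
    · rw [Finsupp.notMem_support_iff.1 hk']; omega
  choose W hW using hpathM
  obtain ⟨S, hAS, hS⟩ := exists_small_elementarySubstructure_of_countable (L := L)
    (A := (⋃ i, ⋃ j, Set.range (a i j)) ∪ ⋃ s, ⋃ η, {W s η})
    (((Set.countable_iUnion fun i => Set.countable_iUnion fun j => Set.countable_range _)).union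
      (Set.countable_iUnion fun s => Set.countable_iUnion fun η => Set.countable_singleton _))
  have ha : ∀ i j t, a i j t ∈ S := fun i j t => hAS <| Or.inl <|
    Set.mem_iUnion.2 ⟨i, Set.mem_iUnion.2 ⟨j, t, rfl⟩⟩
  have hWS : ∀ s η, W s η ∈ S := fun s η => hAS <| Or.inr <|
    Set.mem_iUnion.2 ⟨s, Set.mem_iUnion.2 ⟨η, rfl⟩⟩
  have : Nonempty S := ⟨⟨_, hWS ∅ 0⟩⟩
  let S' : (L.completeTheory R).ModelType := Theory.ModelType.of _ S
  let K : Theory.ModelType.{u, v, max u v} (L.completeTheory R) := S'.shrink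
  let e : S ≃[L] K := (equivShrink S).inducedStructureEquiv
  have he : ∀ i (x : S) (c : Fin (n i) → S),
      (ψ i).Realize (Sum.elim (fun _ : Fin 1 => e x) (fun t => e (c t))) ↔
      (ψ i).Realize (Sum.elim (fun _ : Fin 1 => (x : M)) (fun t => (c t : M))) := by
    intro i x c
    rw [← StrongHomClass.realize_formula e.symm, ← S.subtype.map_formula]
    congr! 1
    funext z
    rcases z with z | z <;> simp
  refine ⟨K, 1, n, ψ, fun _ => 2, fun i j t => e ⟨a i j t, ha i j t⟩, fun _ => two_pos, ?_, ?_⟩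
  · rintro i s hs ⟨x, hx⟩
    obtain ⟨j, j', hjj, rfl⟩ := Finset.card_eq_two.1 hs
    obtain ⟨y, hy⟩ := e.surjective (x 0)
    obtain ⟨Y, hY⟩ := hsurj y
    have hx0 : x = fun _ => e y := by
      funext k; rw [Subsingleton.elim k 0, hy]
    subst hx0
    have key : ∀ l ∈ ({j, j'} : Finset ℕ), ∀ᶠ N in (U : Filter ℕ),
        (ψ i).Realize (Sum.elim (fun _ => Y N) (b N i l)) := by
      intro l hl
      rw [← los, hY]
      exact (he i y _).1 (hx l hl)
    have := (key j (by simp)).and ((key j' (by simp)).and ((hU i).and ((hU j).and (hU j'))))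
    obtain ⟨N, h1, h2, h3, h4, h5⟩ := this.exists
    exact hrow N i h3 j h4 j' h5 hjj _ h1 h2
  · intro η s
    let η' : ℕ →₀ ℕ := Finsupp.indicator s fun i _ => η i
    refine ⟨fun _ => e ⟨W s η', hWS s η'⟩, fun i hi => (he i _ _).2 ?_⟩
    have := hW s η' i hi
    rwa [show η' i = η i from Finsupp.indicator_of_mem hi _] at this

theorem hasInpPattern_of_definable {L : FirstOrder.Language.{u, v}} {R : Type w}
    [L.Structure R] [Nonempty R] {V : Type*} (P : ℕ → (V → R) → R → Prop)
    (hP : ∀ i, (Set.univ : Set R).Definable L {w : Option V → R | P i (w ∘ some) (w none)})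
    (a : ℕ → ℕ → ℕ → V → R)
    (hrow : ∀ N, ∀ i < N, ∀ j < N, ∀ j' < N, j ≠ j' → ∀ x, P i (a N i j) x → ¬ P i (a N i j') x)
    (hpath : ∀ N, ∀ η : ℕ → ℕ, (∀ i < N, η i < N) → ∃ x, ∀ i < N, P i (a N i (η i)) x) :
    HasInpPattern (L.completeTheory R) ℕ := by
  choose n ψ ρ h using fun i => (hP i).exists_formula_split
  refine hasInpPattern_of_formulas ψ (fun N i j => Sum.elim id (a N i j) ∘ ρ i) ?_ ?_
  · simpa only [← h] using hrow
  · simpa only [← h] using hpath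

/-! ### Closure properties of definable sets and functions -/

section DefinabilityTools

variable {L : FirstOrder.Language.{u, v}} {R : Type w} [L.Structure R] {α : Type*}

theorem Set.DefinableFun.comp_some {f : (α → R) → R} (hf : (Set.univ : Set R).DefinableFun L f) :
    (Set.univ : Set R).DefinableFun L fun w : Option α → R => f (w ∘ some) := by
  have h : (Set.univ : Set R).Definable L (Function.tupleGraph f) := hf
  exact h.preimage_comp (fun o : Option α => o.map some)

theorem Set.Definable.exists_option {P : (α → R) → R → Prop}
    (h : (Set.univ : Set R).Definable L {w : Option α → R | P (w ∘ some) (w none)}) :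
    (Set.univ : Set R).Definable L {v : α → R | ∃ x, P v x} := by
  have h' := (h.preimage_comp (fun o : Option α => o.elim (Sum.inr ()) Sum.inl)).exists_of_finite
  convert h' using 1
  ext v
  constructor
  · rintro ⟨x, hx⟩
    exact ⟨fun _ => x, hx⟩
  · rintro ⟨u, hu⟩
    exact ⟨u (), hu⟩

theorem Set.Definable.and {P Q : (α → R) → Prop}
    (hP : (Set.univ : Set R).Definable L {v | P v})
    (hQ : (Set.univ : Set R).Definable L {v | Q v}) :
    (Set.univ : Set R).Definable L {v | P v ∧ Q v} := hP.inter hQ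

theorem Set.Definable.not {P : (α → R) → Prop} (hP : (Set.univ : Set R).Definable L {v | P v}) :
    (Set.univ : Set R).Definable L {v | ¬ P v} := hP.compl

theorem Set.Definable.imp {P Q : (α → R) → Prop}
    (hP : (Set.univ : Set R).Definable L {v | P v})
    (hQ : (Set.univ : Set R).Definable L {v | Q v}) :
    (Set.univ : Set R).Definable L {v | P v → Q v} := by
  convert (hP.and hQ.not).not using 3
  tauto

theorem Set.Definable.forall_option {P : (α → R) → R → Prop}
    (h : (Set.univ : Set R).Definable L {w : Option α → R | P (w ∘ some) (w none)}) :
    (Set.univ : Set R).Definable L {v : α → R | ∀ x, P v x} := by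
  convert (Set.Definable.exists_option (P := fun v x => ¬ P v x) h.not).not using 3
  simp

theorem Set.Definable.comp₁ {A : Set R} (hA : (Set.univ : Set R).Definable₁ L A)
    {f : (α → R) → R} (hf : (Set.univ : Set R).DefinableFun L f) :
    (Set.univ : Set R).Definable L {v | f v ∈ A} :=
  Set.Definable.preimage_map (F := fun v => ![f v]) (fun i => by fin_cases i; exact hf) hA

theorem Set.Definable.comp₂ {A : R → R → Prop}
    (hA : (Set.univ : Set R).Definable L {w : Fin 2 → R | A (w 0) (w 1)})
    {f g : (α → R) → R} (hf : (Set.univ : Set R).DefinableFun L f)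
    (hg : (Set.univ : Set R).DefinableFun L g) :
    (Set.univ : Set R).Definable L {v | A (f v) (g v)} :=
  Set.Definable.preimage_map (F := fun v => ![f v, g v])
    (fun i => by fin_cases i; exacts [hf, hg]) hA

variable [AddCommGroup R] [LinearOrder R] [IsOrderedAddMonoid R] [OAGExpansion L R]

theorem Set.DefinableFun.add {f g : (α → R) → R} (hf : (Set.univ : Set R).DefinableFun L f)
    (hg : (Set.univ : Set R).DefinableFun L g) :
    (Set.univ : Set R).DefinableFun L fun v => f v + g v := by
  have := (Set.DefinableFun.of_empty (A := (Set.univ : Set R)) (Set.DefinableFun.fun_symbol (M := R)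
    (OAGExpansion.addSymb (L := L) (R := R)))).comp (g := fun v : α → R => ![f v, g v])
    (fun i => by fin_cases i; exacts [hf, hg])
  simpa only [OAGExpansion.funMap_addSymb] using this

theorem Set.Definable.lt {f g : (α → R) → R} (hf : (Set.univ : Set R).DefinableFun L f)
    (hg : (Set.univ : Set R).DefinableFun L g) :
    (Set.univ : Set R).Definable L {v | f v < g v} := by
  refine Set.Definable.comp₂ (A := (· < ·)) (Set.Definable.mono (A := ∅) ?_ (Set.empty_subset _))
    hf hg
  refine Set.empty_definable_iff.2
    ⟨(OAGExpansion.ltSymb (L := L) (R := R)).formula₂ (Term.var 0) (Term.var 1), ?_⟩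
  ext w
  simp only [Set.mem_ofPred_eq, Formula.realize_rel₂, Term.realize_var]
  exact (OAGExpansion.relMap_ltSymb _ _).symm

theorem Set.Definable.le {f g : (α → R) → R} (hf : (Set.univ : Set R).DefinableFun L f)
    (hg : (Set.univ : Set R).DefinableFun L g) :
    (Set.univ : Set R).Definable L {v | f v ≤ g v} := by
  simpa only [not_lt] using (Set.Definable.lt (L := L) hg hf).not

end DefinabilityTools

/-! ### Digit expansions by spaced points -/

section Remainders

variable {R : Type w} [AddCommGroup R] [LinearOrder R]

/-- The point `s + z` belongs to the fibre `A t` and no point of the fibre lies strictly between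
`s + z` and `s + z + δ`. -/
def IsSpacedPoint (A : R → R → Prop) (t s δ z : R) : Prop :=
  A t (s + z) ∧ ∀ y, A t y → s + z < y → s + z + δ ≤ y

/-- `r` is left over when `i` spaced points, the `l`-th one from the `l`-th of the given sets, are
subtracted from `x` in turn, with `l`-th remainder in `[0, δ l)`. -/
def IsRemainder (A : R → R → Prop) (t s δ : ℕ → R) : ℕ → R → R → Prop
  | 0, x, r => r = x
  | i + 1, x, r => ∃ z, IsRemainder A t s δ i x (z + r) ∧ IsSpacedPoint A (t i) (s i) (δ i) z ∧
      0 ≤ r ∧ r < δ i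

variable [IsOrderedAddMonoid R] {A : R → R → Prop}

/-- If `z < z'`, spacing would give `z + δ ≤ z' ≤ z' + r' = z + r < z + δ`. -/
theorem IsSpacedPoint.le_of_add_eq {t s δ z z' r r' : R} (h : IsSpacedPoint A t s δ z)
    (h' : IsSpacedPoint A t s δ z') (hr : r < δ) (hr' : 0 ≤ r') (he : z + r = z' + r') :
    z' ≤ z := by
  by_contra! hlt
  have h1 := h.2 _ h'.1 (by simpa using hlt)
  rw [add_assoc, add_le_add_iff_left] at h1
  have : z + δ ≤ z + r := h1.trans (by rw [he]; exact le_add_of_nonneg_right hr')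
  exact absurd hr (not_lt.2 ((add_le_add_iff_left z).1 this))

theorem IsSpacedPoint.eq_of_add_eq {t s δ z z' r r' : R} (h : IsSpacedPoint A t s δ z)
    (h' : IsSpacedPoint A t s δ z') (hr : 0 ≤ r ∧ r < δ) (hr' : 0 ≤ r' ∧ r' < δ)
    (he : z + r = z' + r') : z = z' :=
  le_antisymm (h'.le_of_add_eq h hr'.2 hr.1 he.symm) (h.le_of_add_eq h' hr.2 hr'.1 he)

theorem IsRemainder.unique {t s δ : ℕ → R} {i : ℕ} {x r r' : R}
    (h : IsRemainder A t s δ i x r) (h' : IsRemainder A t s δ i x r') : r = r' := by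
  induction i generalizing r r' with
  | zero => exact Eq.trans h (Eq.symm h')
  | succ i ih =>
    obtain ⟨z, hz, hs, hr⟩ := h
    obtain ⟨z', hz', hs', hr'⟩ := h'
    have he := ih hz hz'
    have := hs.eq_of_add_eq hs' hr hr' he
    subst this
    exact add_left_cancel he

/-- Induction from the last row upwards: the tail after row `i` is at most `M (i + 1)` plus a tail
smaller than `δ (i + 1)`. -/
theorem sum_Ico_spaced_lt {δ M f : ℕ → R} {N : ℕ} (hδ : ∀ i < N, 0 < δ i)
    (hM : ∀ i, i + 1 < N → M (i + 1) + δ (i + 1) ≤ δ i) (hf : ∀ i < N, f i ≤ M i) :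
    ∀ i < N, ∑ l ∈ Finset.Ico (i + 1) N, f l < δ i := by
  intro i hi
  induction hk : N - i generalizing i with
  | zero => omega
  | succ k ih =>
    rcases (show i + 1 = N ∨ i + 1 < N by omega) with rfl | h
    · simpa using hδ i hi
    · rw [Finset.sum_eq_sum_Ico_succ_bot h]
      exact (add_lt_add_of_le_of_lt (hf _ h) (ih (i + 1) h (by omega))).trans_le (hM i h)

theorem isRemainder_sum {t s δ M f : ℕ → R} {N : ℕ} (hδ : ∀ i < N, 0 < δ i)
    (hM : ∀ i, i + 1 < N → M (i + 1) + δ (i + 1) ≤ δ i) (hf : ∀ i < N, f i ≤ M i)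
    (hf0 : ∀ i < N, 0 ≤ f i) (hs : ∀ i < N, IsSpacedPoint A (t i) (s i) (δ i) (f i)) :
    ∀ i ≤ N, IsRemainder A t s δ i (∑ l ∈ Finset.Ico 0 N, f l) (∑ l ∈ Finset.Ico i N, f l) := by
  intro i hi
  induction i with
  | zero => rfl
  | succ i ih =>
    refine ⟨f i, ?_, hs i hi, Finset.sum_nonneg fun l hl => hf0 l (Finset.mem_Ico.1 hl).2,
      sum_Ico_spaced_lt hδ hM hf i hi⟩
    rw [← Finset.sum_eq_sum_Ico_succ_bot (show i < N from hi)]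
    exact ih (Nat.le_of_succ_le hi)

end Remainders

/-! ### The inp-pattern of digits -/

section KeyLemma

variable {L : FirstOrder.Language.{u, v}} {R : Type w} [L.Structure R]
  [AddCommGroup R] [LinearOrder R] [IsOrderedAddMonoid R] [OAGExpansion L R] {A : R → R → Prop}

theorem definable_isSpacedPoint {α : Type*}
    (hA : (Set.univ : Set R).Definable L {w : Fin 2 → R | A (w 0) (w 1)})
    {t s δ z : (α → R) → R} (ht : (Set.univ : Set R).DefinableFun L t)
    (hs : (Set.univ : Set R).DefinableFun L s) (hδ : (Set.univ : Set R).DefinableFun L δ)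
    (hz : (Set.univ : Set R).DefinableFun L z) :
    (Set.univ : Set R).Definable L {v | IsSpacedPoint A (t v) (s v) (δ v) (z v)} := by
  have hy : (Set.univ : Set R).DefinableFun L fun w : Option α → R => w none :=
    Set.DefinableFun.proj L
  have hsz := (hs.add hz).comp_some
  refine (Set.Definable.comp₂ hA ht (hs.add hz)).and (Set.Definable.forall_option ?_)
  exact (Set.Definable.comp₂ hA ht.comp_some hy).imp
    ((Set.Definable.lt hsz hy).imp (Set.Definable.le (hsz.add hδ.comp_some) hy))

/-- Each recursion step quantifies one more variable, so the index type grows; `c` keeps track of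
where the parameters sit. -/
theorem definable_isRemainder
    (hA : (Set.univ : Set R).Definable L {w : Fin 2 → R | A (w 0) (w 1)}) (i : ℕ)
    {α : Type} (c : ℕ × Fin 4 → α)
    {x r : (α → R) → R} (hx : (Set.univ : Set R).DefinableFun L x)
    (hr : (Set.univ : Set R).DefinableFun L r) :
    (Set.univ : Set R).Definable L {v | IsRemainder A (fun k => v (c (k, 0)))
      (fun k => v (c (k, 1))) (fun k => v (c (k, 2))) i (x v) (r v)} := by
  induction i generalizing α with
  | zero => exact hr.ofPred_eq hx
  | succ i ih =>
    have hz : (Set.univ : Set R).DefinableFun L fun w : Option α → R => w none :=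
      Set.DefinableFun.proj L
    refine Set.Definable.exists_option (P := fun v z => _ ∧ _ ∧ _ ∧ _) ?_
    refine (ih (some ∘ c) hx.comp_some (hz.add hr.comp_some)).and
      ((definable_isSpacedPoint hA (.proj L) (.proj L) (.proj L) hz).and
      ((Set.Definable.le (L.definableFun_const _ (Set.mem_univ 0)) hr.comp_some).and
        (Set.Definable.lt hr.comp_some (.proj L))))

/-- Sets of spaced points at infinitely many scales are incompatible with strength. -/
theorem not_isStrongTheory_of_isSpacedPoint
    (hA : (Set.univ : Set R).Definable L {w : Fin 2 → R | A (w 0) (w 1)})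
    (h : ∀ N : ℕ, ∃ (t s δ M : ℕ → R) (e : ℕ → ℕ → R), ∀ i < N, 0 < δ i ∧
      (i + 1 < N → M (i + 1) + δ (i + 1) ≤ δ i) ∧
      ∀ j < N, 0 ≤ e i j ∧ e i j ≤ M i ∧ IsSpacedPoint A (t i) (s i) (δ i) (e i j) ∧
        ∀ j' < N, j ≠ j' → e i j ≠ e i j') :
    ¬ IsStrongTheory (L.completeTheory R) := by
  refine not_not.2 ?_
  choose t s δ M e h using h
  -- The coordinates `(k, 0)`, `(k, 1)`, `(k, 2)` hold `t`, `s`, `δ` of row `k`, the same for every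
  -- formula at stage `N`; only `(i, 3)`, the proposed digit, depends on the column.
  refine hasInpPattern_of_definable (V := ℕ × Fin 4)
    (fun i p x => ∃ r, IsRemainder A (fun k => p (k, 0)) (fun k => p (k, 1)) (fun k => p (k, 2)) i
      x (p (i, 3) + r) ∧ IsSpacedPoint A (p (i, 0)) (p (i, 1)) (p (i, 2)) (p (i, 3)) ∧
      0 ≤ r ∧ r < p (i, 2)) (fun i => ?_)
    (fun N i j q => ![t N q.1, s N q.1, δ N q.1, e N i j] q.2) ?_ ?_
  · refine Set.Definable.exists_option (P := fun v r => _ ∧ _ ∧ _ ∧ _) ?_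
    have hr : (Set.univ : Set R).DefinableFun L
        fun w : Option (Option (ℕ × Fin 4)) → R => w none := .proj L
    exact (definable_isRemainder hA i (some ∘ some)
      (x := fun w : Option (Option (ℕ × Fin 4)) → R => w (some none)) (.proj L)
      (r := fun w => w (some (some (i, 3))) + w none) ((Set.DefinableFun.proj L).add hr)).and
      ((definable_isSpacedPoint hA (.proj L) (.proj L) (.proj L) (.proj L)).and
      ((Set.Definable.le (L.definableFun_const _ (Set.mem_univ 0)) hr).and
        (Set.Definable.lt hr (.proj L))))
  · rintro N i hi j hj j' hj' hjj x ⟨r, h1, h2, h3⟩ ⟨r', h1', h2', h3'⟩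
    have he := h1.unique h1'
    exact ((h N i hi).2.2 j hj).2.2.2 j' hj' hjj (h2.eq_of_add_eq h2' h3 h3' he)
  · intro N η hη
    have hδ := fun i hi => (h N i hi).1
    have hM := fun i (hi : i + 1 < N) => (h N i (by omega)).2.1 hi
    have hf0 := fun i hi => ((h N i hi).2.2 _ (hη i hi)).1
    have hf := fun i hi => ((h N i hi).2.2 _ (hη i hi)).2.1
    have hs := fun i hi => ((h N i hi).2.2 _ (hη i hi)).2.2.1
    refine ⟨∑ l ∈ Finset.Ico 0 N, e N l (η l), fun i hi =>
      ⟨∑ l ∈ Finset.Ico (i + 1) N, e N l (η l), ?_, hs i hi,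
        Finset.sum_nonneg fun l hl => hf0 l (Finset.mem_Ico.1 hl).2,
        sum_Ico_spaced_lt hδ hM hf i hi⟩⟩
    have := isRemainder_sum (A := A) hδ hM hf hf0 hs i hi.le
    rw [Finset.sum_eq_sum_Ico_succ_bot hi] at this
    exact this

end KeyLemma

/-! ### Finite choices and recurring values of sequences -/

theorem Set.Infinite.exists_increasing {α : Type*} [LinearOrder α] {S : Set α} (hS : S.Infinite)
    (n : ℕ) : ∃ C : ℕ → α, (∀ p < n, C p ∈ S) ∧ ∀ p q, p < q → q < n → C p < C q := by
  obtain ⟨F, hFS, hF⟩ := hS.exists_subset_card_eq n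
  obtain ⟨a, -⟩ := hS.nonempty
  refine ⟨fun p => if h : p < n then F.orderEmbOfFin hF ⟨p, h⟩ else a, fun p hp => ?_,
    fun p q hpq hq => ?_⟩
  · simp only [hp, dif_pos]
    exact hFS (F.orderEmbOfFin_mem hF _)
  · simp only [hpq.trans hq, hq, dif_pos]
    exact (F.orderEmbOfFin hF).strictMono hpq

theorem exists_isLeast_frequently {α : Type*} [LinearOrder α] {f : ℕ → α}
    (hf : (Set.range f).Finite) :
    ∃ C, IsLeast {C' | ∃ᶠ l in atTop, f l = C'} C := by
  have hne : {C' | ∃ᶠ l in atTop, f l = C'}.Nonempty := by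
    by_contra h
    have h' : ∀ C ∈ Set.range f, ∀ᶠ l in atTop, f l ≠ C := fun C _ => by
      by_contra hC
      exact h ⟨C, by simpa [Filter.Frequently] using hC⟩
    obtain ⟨l, hl⟩ := ((eventually_all_finite hf).2 h').exists
    exact hl _ ⟨l, rfl⟩ rfl
  have hfin : {C' | ∃ᶠ l in atTop, f l = C'}.Finite :=
    hf.subset fun C hC => hC.exists
  obtain ⟨C, hC, hmin⟩ := Set.exists_min_image _ id hfin hne
  exact ⟨C, hC, hmin⟩

theorem eventually_le_of_isLeast_frequently {α : Type*} [LinearOrder α] {f : ℕ → α}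
    (hf : (Set.range f).Finite) {C : α} (hC : IsLeast {C' | ∃ᶠ l in atTop, f l = C'} C) :
    ∀ᶠ l in atTop, C ≤ f l := by
  have h' : ∀ C' ∈ Set.range f, ∀ᶠ l in atTop, f l = C' → C ≤ C' := fun C' _ => by
    by_cases h : C ≤ C'
    · exact .of_forall fun _ _ => h
    · have : ¬ ∃ᶠ l in atTop, f l = C' := fun hC' => h (hC.2 hC')
      filter_upwards [not_frequently.1 this] with l hl hl'
      exact (hl hl').elim
  filter_upwards [(eventually_all_finite hf).2 h'] with l hl
  exact hl _ ⟨l, rfl⟩ rfl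

/-! ### Successor chains -/

section Chains

variable {R : Type w} [LinearOrder R] {D : Set R} {a : R} {c : ℕ → R}

theorem IsSuccIn.unique {b b' : R} (h : IsSuccIn D a b) (h' : IsSuccIn D a b') : b = b' :=
  h.2.unique h'.2

theorem IsSuccIn.lt {b : R} (h : IsSuccIn D a b) : a < b := h.2.1.2

theorem IsPredIn.isSuccIn {b : R} (h : IsPredIn D a b) : IsSuccIn D b a :=
  ⟨h.2.1.1, ⟨h.1, h.2.1.2⟩, fun _ hx => not_lt.1 fun hxa => (h.2.2 ⟨hx.1, hxa⟩).not_gt hx.2⟩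

theorem zChainGE_subset_of_mem_zChainLE {b : R} (hb : b ∈ zChainLE D a) :
    zChainGE D a ⊆ zChainGE D b := by
  intro x hx
  have hb' : Relation.ReflTransGen (IsPredIn D) a b := hb
  have hba : Relation.ReflTransGen (IsSuccIn D) b a := by
    clear hb hx
    induction hb' with
    | refl => exact .refl
    | tail _ h ih => exact .head h.isSuccIn ih
  exact hba.trans hx

theorem strictMono_of_isSuccIn (hc : ∀ k, IsSuccIn D (c k) (c (k + 1))) : StrictMono c :=
  strictMono_nat_of_lt_succ fun k => (hc k).lt

theorem exists_eq_of_isSuccIn_chain (hc : ∀ k, IsSuccIn D (c k) (c (k + 1))) {y : R} (hy : y ∈ D)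
    (h0 : c 0 ≤ y) {m : ℕ} (hm : y < c m) : ∃ k < m, c k = y := by
  induction m with
  | zero => exact absurd hm h0.not_gt
  | succ m ih =>
    rcases lt_trichotomy y (c m) with h | h | h
    · obtain ⟨k, hk, h⟩ := ih h
      exact ⟨k, hk.trans (Nat.lt_succ_self m), h⟩
    · exact ⟨m, Nat.lt_succ_self m, h.symm⟩
    · exact absurd ((hc m).2.2 ⟨hy, h⟩) hm.not_ge

theorem mem_zChainGE_iff (hc : ∀ k, IsSuccIn D (c k) (c (k + 1))) {k : ℕ} {x : R} :
    x ∈ zChainGE D (c k) ↔ ∃ l ≥ k, c l = x := by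
  constructor
  · intro hx
    have hx' : Relation.ReflTransGen (IsSuccIn D) (c k) x := hx
    induction hx' with
    | refl => exact ⟨k, le_rfl, rfl⟩
    | tail h1 h2 ih =>
      obtain ⟨l, hl, rfl⟩ := ih h1
      exact ⟨l + 1, hl.trans (Nat.le_succ l), (hc l).unique h2⟩
  · rintro ⟨l, hl, rfl⟩
    induction l, hl using Nat.le_induction with
    | base => exact Relation.ReflTransGen.refl
    | succ l _ ih => exact Relation.ReflTransGen.tail ih (hc l)

theorem exists_isSuccIn_chain (h : ∀ b ∈ zChainGE D a, ∃ b', IsSuccIn D b b') :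
    ∃ c : ℕ → R, c 0 = a ∧ ∀ k, IsSuccIn D (c k) (c (k + 1)) := by
  choose! S hS using h
  have hmem : ∀ k, S^[k] a ∈ zChainGE D a := fun k => by
    induction k with
    | zero => exact Relation.ReflTransGen.refl
    | succ k ih =>
      rw [Function.iterate_succ_apply']
      exact Relation.ReflTransGen.tail ih (hS _ ih)
  refine ⟨fun k => S^[k] a, rfl, fun k => ?_⟩
  simp only [Function.iterate_succ_apply']
  exact hS _ (hmem k)

variable [AddCommGroup R] [IsOrderedAddMonoid R]

theorem representedGE_iff (hc : ∀ k, IsSuccIn D (c k) (c (k + 1))) {k : ℕ}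
    {C : ArchimedeanClass R} :
    RepresentedGE D (c k) C ↔ ∃ l ≥ k, ArchimedeanClass.mk (c (l + 1) - c l) = C := by
  constructor
  · rintro ⟨x, hx, d, hd, rfl⟩
    obtain ⟨l, hl, rfl⟩ := (mem_zChainGE_iff hc).1 hx
    exact ⟨l, hl, by rw [(hc l).unique hd]⟩
  · rintro ⟨l, hl, rfl⟩
    exact ⟨c l, (mem_zChainGE_iff hc).2 ⟨l, hl, rfl⟩, _, hc l, rfl⟩

/-- Every tail of the `ℤ`-chain either is a tail of `c` or, if it starts below `c 0`, contains all
of `c`. So being represented in every tail means recurring infinitely often along `c`. -/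
theorem isCStar_iff (hc : ∀ k, IsSuccIn D (c k) (c (k + 1))) {C : ArchimedeanClass R} :
    IsCStar D (c 0) C ↔
      IsLeast {C' | ∃ᶠ l in atTop, ArchimedeanClass.mk (c (l + 1) - c l) = C'} C := by
  have : {C' : ArchimedeanClass R | ∀ b ∈ zChain D (c 0), RepresentedGE D b C'} =
      {C' | ∃ᶠ l in atTop, ArchimedeanClass.mk (c (l + 1) - c l) = C'} := by
    ext C'
    rw [Set.mem_ofPred_eq, Set.mem_ofPred_eq, frequently_atTop]
    constructor
    · intro h k
      exact (representedGE_iff hc).1 (h _ (.inl ((mem_zChainGE_iff hc).2 ⟨k, Nat.zero_le k, rfl⟩)))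
    · rintro h b (hb | hb)
      · obtain ⟨k, -, rfl⟩ := (mem_zChainGE_iff hc).1 hb
        exact (representedGE_iff hc).2 (h k)
      · obtain ⟨x, hx, h'⟩ := (representedGE_iff hc).2 (h 0)
        exact ⟨x, zChainGE_subset_of_mem_zChainLE hb hx, h'⟩
  rw [IsCStar, this]

theorem IsCStar.exists_chain {C : ArchimedeanClass R} (h : IsCStar D a C) :
    ∃ c : ℕ → R, c 0 = a ∧ ∀ k, IsSuccIn D (c k) (c (k + 1)) := by
  refine exists_isSuccIn_chain fun b hb => ?_
  obtain ⟨x, hx, d, hd, -⟩ := h.1 b (.inl hb)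
  rcases Relation.ReflTransGen.cases_head hx with rfl | ⟨b', hb', -⟩
  exacts [⟨d, hd⟩, ⟨b', hb'⟩]

theorem le_mk_sub_of_chain {C : ArchimedeanClass R} {k : ℕ}
    (hC : ∀ l ≥ k, C ≤ ArchimedeanClass.mk (c (l + 1) - c l)) {l : ℕ} (hl : k ≤ l) :
    C ≤ ArchimedeanClass.mk (c l - c k) := by
  induction l, hl using Nat.le_induction with
  | base => simp
  | succ l hl ih =>
    rw [← sub_add_sub_cancel (c (l + 1)) (c l) (c k)]
    exact (le_min (hC l hl) ih).trans (ArchimedeanClass.min_le_mk_add _ _)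

end Chains

/-! ### Consequences of strength for discrete sets -/

section Strong

theorem exists_pos_forall_le {R : Type*} [LinearOrder R] [Zero R] {ρ : ℕ → R} (hρ : ∀ k, 0 < ρ k) {M : R} (hM : 0 < M) (N : ℕ) :
    ∃ δ, 0 < δ ∧ δ ≤ M ∧ ∀ k < N, δ ≤ ρ k := by
  induction N with
  | zero => exact ⟨M, hM, le_rfl, by simp⟩
  | succ N ih =>
    obtain ⟨δ, h0, h1, h2⟩ := ih
    refine ⟨min δ (ρ N), lt_min h0 (hρ N), (min_le_left _ _).trans h1, fun k hk => ?_⟩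
    rcases Nat.lt_succ_iff_lt_or_eq.1 hk with h | rfl
    exacts [(min_le_left _ _).trans (h2 k h), min_le_right _ _]

theorem definable_const_mem {L : FirstOrder.Language.{u, v}} {R : Type w} [L.Structure R] {D : Set R}
    (hdef : (Set.univ : Set R).Definable₁ L D) :
    (Set.univ : Set R).Definable L {w : Fin 2 → R | w 1 ∈ D} :=
  Set.Definable.comp₁ hdef (.proj L)

variable {L : FirstOrder.Language.{u, v}} {R : Type w} [L.Structure R]
  [AddCommGroup R] [LinearOrder R] [IsOrderedAddMonoid R] [OAGExpansion L R] {D : Set R}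

theorem IsDiscrete.exists_gap [TopologicalSpace R] [OrderTopology R] (hD : IsDiscrete D)
    {x ε : R} (hx : x ∈ D) (hε : 0 < ε) : ∃ ρ, 0 < ρ ∧ ∀ y ∈ D, x < y → x + ρ ≤ y := by
  obtain ⟨U, hU, hUD⟩ := isDiscrete_iff_forall_mem_exists_isOpen.1 hD x hx
  have hxU : x ∈ U ∩ D := hUD ▸ rfl
  obtain ⟨z, hz, hz'⟩ := exists_Ico_subset_of_mem_nhds (hU.mem_nhds hxU.1)
    ⟨x + ε, lt_add_of_pos_right x hε⟩
  refine ⟨z - x, sub_pos.2 hz, fun y hy hxy => ?_⟩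
  rw [add_sub_cancel]
  by_contra! hyz
  have : y ∈ U ∩ D := ⟨hz' ⟨hxy.le, hyz⟩, hy⟩
  rw [hUD] at this
  exact hxy.ne' this

/-- The points descend towards `s`. Discreteness gives each a positive gap above it, and `δ` is
taken below the first `N` of these gaps. -/
theorem exists_spaced_row [TopologicalSpace R] [OrderTopology R] (hD : IsDiscrete D) {s : R}
    (hs : ∀ ε > 0, ∃ y ∈ D, s < y ∧ y < s + ε) (N : ℕ) {d : R} (hd : 0 < d) :
    ∃ (M δ : R) (e : ℕ → R), 0 < δ ∧ M + δ ≤ d ∧ ∀ j < N, 0 ≤ e j ∧ e j ≤ M ∧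
      IsSpacedPoint (fun _ x => x ∈ D) 0 s δ (e j) ∧ ∀ j' < N, j ≠ j' → e j ≠ e j' := by
  have hs' : ∀ ε, ∃ z, 0 < ε → s + z ∈ D ∧ 0 < z ∧ z < ε := fun ε => by
    by_cases hε : 0 < ε
    · obtain ⟨y, hy, h1, h2⟩ := hs ε hε
      exact ⟨y - s, fun _ => ⟨by rwa [add_sub_cancel], sub_pos.2 h1, sub_lt_iff_lt_add'.2 h2⟩⟩
    · exact ⟨0, fun h => (hε h).elim⟩
  choose g hg using hs'
  obtain ⟨-, hx0, hxd⟩ := hg d hd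
  -- `M` is below both `g d` and `d - g d`, so `δ ≤ M` will give `M + δ ≤ d`.
  obtain ⟨hMD, hM0, hM⟩ := hg _ (lt_min hx0 (sub_pos.2 hxd))
  obtain ⟨hM1, hM2⟩ := lt_min_iff.1 hM
  set M := g (min (g d) (d - g d))
  let e : ℕ → R := fun k => g^[k] M
  have he : ∀ k, s + e k ∈ D ∧ 0 < e k := fun k => by
    induction k with
    | zero => exact ⟨hMD, hM0⟩
    | succ k ih =>
      have := hg _ ih.2
      simp only [e, Function.iterate_succ_apply']
      exact ⟨this.1, this.2.1⟩
  have hanti : StrictAnti e := strictAnti_nat_of_succ_lt fun k => by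
    simp only [e, Function.iterate_succ_apply']
    exact (hg _ (he k).2).2.2
  choose ρ hρ0 hρ using fun k => hD.exists_gap (he k).1 hd
  obtain ⟨δ, h0, h1, h2⟩ := exists_pos_forall_le hρ0 hM0 N
  refine ⟨M, δ, e, h0, ?_, fun j hj => ⟨(he j).2.le, hanti.antitone (Nat.zero_le j),
    ⟨(he j).1, fun y hy hlt => ?_⟩, fun j' _ hjj => hanti.injective.ne hjj⟩⟩
  · calc M + δ ≤ g d + (d - g d) := add_le_add hM1.le (h1.trans hM2.le)
      _ = d := add_sub_cancel _ _
  · exact (add_le_add_right (h2 j hj) _).trans (hρ j y hy hlt)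

/-- In a strong expansion a definable discrete set does not accumulate from above. -/
theorem not_accumulates_of_isStrongTheory [TopologicalSpace R] [OrderTopology R]
    (hstrong : IsStrongTheory (L.completeTheory R))
    (hdef : (Set.univ : Set R).Definable₁ L D) (hD : IsDiscrete D) (s : R) {d : R}
    (hd : 0 < d) : ¬ ∀ ε > 0, ∃ y ∈ D, s < y ∧ y < s + ε := by
  intro hs
  refine not_isStrongTheory_of_isSpacedPoint (L := L) (A := fun _ x => x ∈ D)
    (definable_const_mem hdef) (fun N => ?_) hstrong
  have hrow := fun x : R => fun hx : 0 < x => exists_spaced_row hD hs N hx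
  choose! M δ e h0 h1 h2 using hrow
  -- Row `i` fits below `σ i`, and its spacing `σ (i + 1)` bounds the next row.
  let σ : ℕ → R := fun k => δ^[k] d
  have hσ : ∀ k, σ (k + 1) = δ (σ k) := fun k => Function.iterate_succ_apply' δ k d
  have hσ0 : ∀ k, 0 < σ k := fun k => by
    induction k with
    | zero => exact hd
    | succ k ih => rw [hσ]; exact h0 _ ih
  refine ⟨fun _ => 0, fun _ => s, fun i => σ (i + 1), fun i => M (σ i), fun i => e (σ i),
    fun i _ => ⟨hσ0 _, fun _ => ?_, ?_⟩⟩
  · simp only [hσ (i + 1)]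
    exact h1 _ (hσ0 _)
  · simp only [hσ i]
    exact h2 _ (hσ0 i)

theorem exists_isSuccIn [TopologicalSpace R] [OrderTopology R]
    (hcomplete : DefinablyComplete L R) (hstrong : IsStrongTheory (L.completeTheory R))
    (hdef : (Set.univ : Set R).Definable₁ L D) (hD : IsDiscrete D) {a b : R} (ha : a ∈ D)
    (hb : b ∈ D) (hab : a < b) : ∃ b', IsSuccIn D a b' := by
  -- The supremum of this set of lower bounds is the infimum of the part of `D` above `a`; if it is
  -- not attained, `D` accumulates at it from above.
  have hX : (Set.univ : Set R).Definable₁ L {x | ∀ y, y ∈ D → a < y → x ≤ y} := by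
    refine Set.Definable.forall_option ?_
    have hy : (Set.univ : Set R).DefinableFun L fun w : Option (Fin 1) → R => w none := .proj L
    exact (Set.Definable.comp₁ hdef hy).imp
      ((Set.Definable.lt (L.definableFun_const _ (Set.mem_univ a)) hy).imp
        (Set.Definable.le (.proj L) hy))
  obtain ⟨s, hs⟩ := hcomplete _ hX ⟨a, fun y _ h => h.le⟩ ⟨b, fun x hx => hx b hb hab⟩
  have hsy : ∀ y ∈ D, a < y → s ≤ y := fun y hy hay => hs.2 fun x hx => hx y hy hay
  by_contra hno
  refine not_accumulates_of_isStrongTheory hstrong hdef hD s (sub_pos.2 hab) fun ε hε => ?_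
  by_contra! h
  have : s + ε ≤ s := hs.1 fun y hy hay => by
    rcases (hsy y hy hay).lt_or_eq with h' | rfl
    · exact h y hy h'
    · exact (hno ⟨s, ha, ⟨hy, hay⟩, fun z hz => hsy z hz.1 hz.2⟩).elim
  exact absurd this (not_le.2 (lt_add_of_pos_right s hε))

/-- In a strong expansion only finitely many Archimedean classes occur among the gaps of a chain of
successors in a definable set. -/
theorem finite_range_mk_gap (hstrong : IsStrongTheory (L.completeTheory R))
    (hdef : (Set.univ : Set R).Definable₁ L D) {c : ℕ → R}
    (hc : ∀ k, IsSuccIn D (c k) (c (k + 1))) :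
    (Set.range fun k => ArchimedeanClass.mk (c (k + 1) - c k)).Finite := by
  by_contra hinf
  -- `A t` is the set of gaps `S_D(y) - y` with `c 0 ≤ y < t`. The chain itself need not be
  -- definable, but cutting at `t = c m` leaves finitely many gaps, uniformly in the parameter `t`.
  let A : R → R → Prop := fun t x => ∃ y, c 0 ≤ y ∧ y < t ∧ y ∈ D ∧ y + x ∈ D ∧ y < y + x ∧
    ∀ z, z ∈ D → y < z → y + x ≤ z
  have hA : (Set.univ : Set R).Definable L {w : Fin 2 → R | A (w 0) (w 1)} := by
    refine Set.Definable.exists_option ?_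
    have hy : (Set.univ : Set R).DefinableFun L fun w : Option (Fin 2) → R => w none := .proj L
    have hyx : (Set.univ : Set R).DefinableFun L
      fun w : Option (Fin 2) → R => w none + w (some 1) := .add hy (.proj L)
    have hz : (Set.univ : Set R).DefinableFun L
      fun w : Option (Option (Fin 2)) → R => w none := .proj L
    refine (Set.Definable.le (L.definableFun_const _ (Set.mem_univ _)) hy).and
      ((Set.Definable.lt hy (.proj L)).and ((Set.Definable.comp₁ hdef hy).and
      ((Set.Definable.comp₁ hdef hyx).and ((Set.Definable.lt hy hyx).and
      (Set.Definable.forall_option ?_)))))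
    exact (Set.Definable.comp₁ hdef hz).imp
      ((Set.Definable.lt hy.comp_some hz).imp (Set.Definable.le hyx.comp_some hz))
  have hAc : ∀ m x, A (c m) x ↔ ∃ k < m, c (k + 1) - c k = x := by
    intro m x
    constructor
    · rintro ⟨y, h0, hm, hy, hyx, hlt, hmin⟩
      obtain ⟨k, hk, rfl⟩ := exists_eq_of_isSuccIn_chain hc hy h0 hm
      have : c (k + 1) = c k + x :=
        (hc k).unique ⟨hy, ⟨hyx, hlt⟩, fun z hz => hmin z hz.1 hz.2⟩
      exact ⟨k, hk, by rw [this, add_sub_cancel_left]⟩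
    · rintro ⟨k, hk, rfl⟩
      have hm := strictMono_of_isSuccIn hc
      refine ⟨c k, hm.monotone (Nat.zero_le k), hm hk, (hc k).1, ?_⟩
      rw [add_sub_cancel]
      exact ⟨(hc k).2.1.1, (hc k).lt, fun z hz hlt => (hc k).2.2 ⟨hz, hlt⟩⟩
  have hpos : ∀ m x, A (c m) x → 0 < x := fun m x ⟨y, _, _, _, _, h, _⟩ =>
    (lt_add_iff_pos_right y).1 h
  refine not_isStrongTheory_of_isSpacedPoint hA (fun N => ?_) hstrong
  -- `N` rows of `N` classes each; increasing in Mathlib's order means that the gaps shrink.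
  obtain ⟨C, hC, hCmono⟩ := Set.Infinite.exists_increasing hinf (N * N)
  have hC' : ∀ p, ∃ k, p < N * N → ArchimedeanClass.mk (c (k + 1) - c k) = C p := fun p => by
    by_cases hp : p < N * N
    · obtain ⟨k, hk⟩ := hC p hp
      exact ⟨k, fun _ => hk⟩
    · exact ⟨0, fun h => (hp h).elim⟩
  choose κ hκ using hC'
  let m := (Finset.range (N * N)).sup κ + 1
  have hfin : {x | A (c m) x}.Finite := by
    refine ((Finset.range m).finite_toSet.image fun k => c (k + 1) - c k).subset ?_
    intro x hx
    obtain ⟨k, hk, rfl⟩ := (hAc m x).1 hx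
    exact ⟨k, by simpa using hk, rfl⟩
  -- With `G p` the largest gap of its class, any larger gap in `A (c m)` lies in a larger class and
  -- exceeds `G p + G p`; this gives the spacing.
  have hG : ∀ p, ∃ G, p < N * N → A (c m) G ∧ ArchimedeanClass.mk G = C p ∧
      ∀ y, A (c m) y → ArchimedeanClass.mk y = C p → y ≤ G := fun p => by
    by_cases hp : p < N * N
    · obtain ⟨G, hG, hmax⟩ := Set.exists_max_image
        {x | A (c m) x ∧ ArchimedeanClass.mk x = C p} id
        (hfin.subset fun x hx => hx.1) ⟨c (κ p + 1) - c (κ p), (hAc m _).2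
          ⟨κ p, Nat.lt_succ_of_le (Finset.le_sup (f := κ) (Finset.mem_range.2 hp)), rfl⟩, hκ p hp⟩
      exact ⟨G, fun _ => ⟨hG.1, hG.2, fun y h1 h2 => hmax y ⟨h1, h2⟩⟩⟩
    · exact ⟨0, fun h => (hp h).elim⟩
  choose G hG using hG
  have hG0 : ∀ p < N * N, 0 < G p := fun p hp => hpos m _ (hG p hp).1
  have two : ∀ x y : R, 0 < x → 0 < y → ArchimedeanClass.mk y < ArchimedeanClass.mk x →
      x + x < y := fun x y hx hy h => by
    have := ArchimedeanClass.mk_lt_mk.1 h 2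
    rwa [abs_of_pos hx, abs_of_pos hy, two_nsmul] at this
  have hGG : ∀ p q, p < q → q < N * N → G q + G q < G p := fun p q hpq hq => by
    have hp := hpq.trans hq
    refine two _ _ (hG0 q hq) (hG0 p hp) ?_
    rw [(hG p hp).2.1, (hG q hq).2.1]
    exact hCmono p q hpq hq
  have hlt : ∀ p q, p < q → q < N * N → G q < G p := fun p q hpq hq =>
    (lt_add_of_pos_right _ (hG0 q hq)).trans (hGG p q hpq hq)
  have hle : ∀ p q, p ≤ q → q < N * N → G q ≤ G p := fun p q hpq hq => by
    rcases hpq.lt_or_eq with h | rfl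
    exacts [(hlt p q h hq).le, le_rfl]
  have hidx : ∀ i j, i < N → j < N → i * N + j < N * N := fun i j hi hj => by nlinarith
  -- Row `i` is the block of indices from `i * N` to `i * N + (N - 1)`: its first element is the
  -- bound `M`, its last and smallest is the spacing `δ`.
  refine ⟨fun _ => c m, fun _ => 0, fun i => G (i * N + (N - 1)), fun i => G (i * N),
    fun i j => G (i * N + j), fun i hi => ⟨hG0 _ (hidx i _ hi (by omega)), fun hi' => ?_,
    fun j hj => ⟨(hG0 _ (hidx i j hi hj)).le, hle _ _ (by omega) (hidx i j hi hj), ?_, ?_⟩⟩⟩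
  · have h1 : (i + 1) * N < N * N := by simpa using hidx (i + 1) 0 hi' (by omega)
    refine le_trans (add_le_add_right (hle _ _ (Nat.le_add_right _ _)
      (hidx (i + 1) (N - 1) hi' (by omega))) _) (hGG _ _ ?_ h1).le
    rw [Nat.succ_mul]
    omega
  · have hp := hidx i j hi hj
    simp only [IsSpacedPoint, zero_add]
    refine ⟨(hG _ hp).1, fun y hy hlt' => ?_⟩
    have h1 : ArchimedeanClass.mk y ≠ C (i * N + j) := fun h =>
      ((hG _ hp).2.2 y hy h).not_gt hlt'
    have h2 : ArchimedeanClass.mk y ≤ ArchimedeanClass.mk (G (i * N + j)) :=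
      ArchimedeanClass.mk_antitoneOn (hG0 _ hp).le (hpos m y hy).le hlt'.le
    have h3 := two _ _ (hG0 _ hp) (hpos m y hy) (h2.lt_of_ne (by rwa [(hG _ hp).2.1]))
    exact (add_le_add_right (hle _ _ (by omega) (hidx i (N - 1) hi (by omega))) _).trans h3.le
  · intro j' hj' hjj
    rcases lt_or_gt_of_ne hjj with h | h
    · exact (hlt _ _ (by omega) (hidx i j' hi hj')).ne'
    · exact (hlt _ _ (by omega) (hidx i j hi hj)).ne

/-- Since only finitely many classes occur along the chain, from some index `K` on no gap exceeds
`C`, while gaps of class `C` recur. The points starting such gaps form the row, and its total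
length, a finite sum of gaps, still does not exceed class `C`. -/
theorem IsCStar.exists_spaced_row (hstrong : IsStrongTheory (L.completeTheory R))
    (hdef : (Set.univ : Set R).Definable₁ L D) {a : R} {C : ArchimedeanClass R}
    (h : IsCStar D a C) (N : ℕ) :
    ∃ (s δ M : R) (e : ℕ → R), 0 < δ ∧ ArchimedeanClass.mk δ = C ∧ C ≤ ArchimedeanClass.mk M ∧
      ∀ j < N, 0 ≤ e j ∧ e j ≤ M ∧ IsSpacedPoint (fun _ x => x ∈ D) 0 s δ (e j) ∧
        ∀ j' < N, j ≠ j' → e j ≠ e j' := by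
  obtain ⟨c, rfl, hc⟩ := h.exists_chain
  have hC := (isCStar_iff hc).1 h
  have hm := strictMono_of_isSuccIn hc
  have hev := eventually_le_of_isLeast_frequently (finite_range_mk_gap hstrong hdef hc) hC
  obtain ⟨K, hK⟩ := eventually_atTop.1 hev
  obtain ⟨φ, hφ, hφC⟩ := extraction_of_frequently_atTop
    (hC.1.and_eventually (eventually_ge_atTop K))
  -- The least selected gap serves as `δ`; the range `N + 1` is nonempty even for `N = 0`.
  obtain ⟨j₀, hj₀, hmin⟩ := Finset.exists_min_image (Finset.range (N + 1))
    (fun j => c (φ j + 1) - c (φ j)) ⟨0, by simp⟩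
  refine ⟨c (φ 0), c (φ j₀ + 1) - c (φ j₀), c (φ N) - c (φ 0), fun j => c (φ j) - c (φ 0),
    sub_pos.2 (hc _).lt, (hφC j₀).1, le_mk_sub_of_chain (fun l hl => hK l ((hφC 0).2.trans hl))
      (hφ.monotone (Nat.zero_le N)), fun j hj => ⟨?_, ?_, ⟨?_, fun y hy hlt => ?_⟩, ?_⟩⟩
  · exact sub_nonneg.2 (hm.monotone (hφ.monotone (Nat.zero_le j)))
  · exact sub_le_sub_right (hm.monotone (hφ.monotone hj.le)) _
  · rw [add_sub_cancel]
    exact (hc _).1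
  · rw [add_sub_cancel] at hlt ⊢
    have h1 := hmin j (by simp; omega)
    calc c (φ j) + (c (φ j₀ + 1) - c (φ j₀)) ≤ c (φ j) + (c (φ j + 1) - c (φ j)) :=
          add_le_add_right h1 _
      _ = c (φ j + 1) := add_sub_cancel _ _
      _ ≤ y := (hc _).2.2 ⟨hy, hlt⟩
  · intro j' _ hjj heq
    exact hjj (hφ.injective (hm.injective (sub_left_injective heq)))

theorem finite_setOf_isCStar (hstrong : IsStrongTheory (L.completeTheory R))
    (hdef : (Set.univ : Set R).Definable₁ L D) :
    {C : ArchimedeanClass R | ∃ a ∈ D, IsCStar D a C}.Finite := by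
  by_contra hinf
  refine not_isStrongTheory_of_isSpacedPoint (L := L) (A := fun _ x => x ∈ D)
    (definable_const_mem hdef) (fun N => ?_) hstrong
  obtain ⟨C, hC, hCmono⟩ := Set.Infinite.exists_increasing hinf N
  have hrow := fun i (hi : i < N) =>
    (hC i hi).choose_spec.2.exists_spaced_row hstrong hdef N
  choose! s δ M e h0 hδ hM h using hrow
  refine ⟨fun _ => 0, s, δ, M, e, fun i hi => ⟨h0 i hi, fun hi' => ?_, h i hi⟩⟩
  -- Row `i + 1` belongs to a strictly smaller Archimedean class, so its whole extent is
  -- infinitesimal relative to `δ i`.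
  have h1 : ArchimedeanClass.mk (δ i) < ArchimedeanClass.mk (M (i + 1) + δ (i + 1)) := by
    refine lt_of_lt_of_le ?_ (ArchimedeanClass.min_le_mk_add _ _)
    rw [hδ i hi, hδ _ hi']
    exact (hCmono i (i + 1) (Nat.lt_succ_self i) hi').trans_le (le_min (hM _ hi') le_rfl)
  have h2 := ArchimedeanClass.mk_lt_mk.1 h1 1
  rw [one_nsmul, abs_of_pos (h0 i hi)] at h2
  exact (le_abs_self _).trans h2.le

end Strong

theorem mainTheorem7 (L : FirstOrder.Language.{u, v}) (R : Type w) [AddCommGroup R] [LinearOrder R]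
    [IsOrderedAddMonoid R] [TopologicalSpace R] [OrderTopology R] [L.Structure R]
    [OAGExpansion L R]
    (hcomplete : DefinablyComplete L R)
    (hstrong : IsStrongTheory (L.completeTheory R))
    (D : Set R) (hdef : (Set.univ : Set R).Definable₁ L D) (hdisc : IsDiscrete D) :
    (∀ a ∈ D, (¬ ∃ m ∈ zChain D a, IsGreatest D m) → ∃ C, IsCStar D a C) ∧
      {C : ArchimedeanClass R | ∃ a ∈ D, IsCStar D a C}.Finite := by
  refine ⟨fun a ha hmax => ?_, finite_setOf_isCStar hstrong hdef⟩
  have hsucc : ∀ b ∈ zChainGE D a, ∃ b', IsSuccIn D b b' := fun b hb => by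
    have hbD : b ∈ D := by
      rcases Relation.ReflTransGen.cases_tail hb with rfl | ⟨x, -, hx⟩
      exacts [ha, hx.2.1.1]
    by_contra hno
    refine hmax ⟨b, .inl hb, hbD, fun y hy => not_lt.1 fun hby => hno ?_⟩
    exact exists_isSuccIn hcomplete hstrong hdef hdisc hbD hy hby
  obtain ⟨c, rfl, hc⟩ := exists_isSuccIn_chain hsucc
  obtain ⟨C, hC⟩ := exists_isLeast_frequently (finite_range_mk_gap hstrong hdef hc)
  exact ⟨C, (isCStar_iff hc).2 hC⟩
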